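/- Let $n\ge 1$ and let $\Delta^{n-1}=\{x\in\mathbb R^n : x_i\ge 0 \text{ for all } i,\ \sum_{i=1}^n x_i=1\}$. A point $x\in\Delta^{n-1}$ is called a cut-set; it represents the connected allocation of the cake $[0,1]$ in which agent $i\in\{1,\dots,n\}$ receives the interval $A_i^x=\bigl[\sum_{j<i}x_j,\ x_i+\sum_{j<i}x_j\bigr]$. An instance consists of continuous functions $v_1,\dots,v_n:\Delta^{n-1}\to\mathbb R$ (the valuations of the agents, which may depend on the whole cut-set) such that $v_i(x)=0$ whenever $x_i=0$. The instance is SANN (some agent nonnegative) if for every $x\in\Delta^{n-1}$ there is an agent $i$ with $x_i>0$ and $v_i(x)\ge 0$, and SANP (some agent nonpositive) if for every $x\in\Delta^{n-1}$ there is an agent $i$ with $x_i>0$ and $v_i(x)\le 0$. **Theorem.** Every instance that is SANN or SANP admits a connected equitable allocation, that is, an allocation $A^x=(A_1^x,\dots,A_n^x)$ given by a cut-set $x\in\Delta^{n-1}$ with $v_1(x)=v_2(x)=\cdots=v_n(x)$. -/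

import Mathlib

namespace CakeCutting

/-- A cut-set for `n` agents: a point of the standard `(n-1)`-simplex; `x i` is the length of the
`i`-th piece from the left of the cake `[0,1]`. -/
abbrev CutSet (n : ℕ) : Type := stdSimplex ℝ (Fin n)

/-- The connected allocation given by a cut-set: agent `i` receives the `i`-th subinterval. -/
def CutSet.allocation {n : ℕ} (x : CutSet n) (i : Fin n) : Set ℝ :=
  Set.Icc (∑ j ∈ Finset.Iio i, x j) (x i + ∑ j ∈ Finset.Iio i, x j)

/-- A connected fair division instance with `n` agents and global valuations: continuous
functions of the whole cut-set, with value `0` for an agent whose piece is empty. -/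
structure Instance (n : ℕ) where
  /-- the valuation function of each agent -/
  val : Fin n → CutSet n → ℝ
  continuous_val : ∀ i, Continuous (val i)
  val_eq_zero : ∀ i x, x i = 0 → val i x = 0

namespace Instance

variable {n : ℕ}

/-- Some agent nonnegative: at every cut-set, some agent with a nonempty piece has
nonnegative value. -/
def IsSANN (I : Instance n) : Prop :=
  ∀ x : CutSet n, ∃ i, 0 < x i ∧ 0 ≤ I.val i x

/-- Some agent nonpositive: at every cut-set, some agent with a nonempty piece has
nonpositive value. -/
def IsSANP (I : Instance n) : Prop :=
  ∀ x : CutSet n, ∃ i, 0 < x i ∧ I.val i x ≤ 0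

/-- A cut-set is equitable if all agents have the same value for it. -/
def IsEquitable (I : Instance n) (x : CutSet n) : Prop :=
  ∀ i j, I.val i x = I.val j x

/-- `A` is a connected equitable allocation: the allocation of an equitable cut-set. -/
def IsConnectedEquitableAllocation (I : Instance n) (A : Fin n → Set ℝ) : Prop :=
  ∃ x : CutSet n, A = x.allocation ∧ I.IsEquitable x

end Instance

end CakeCutting

/-! Let M = max v_i and G = Σ_j (M - v_j). The functions h_i = M - v_i - x_i G sum to zero, since Σ
x_i = 1, so at each point one of them is nonnegative; moreover h_i ≥ 0 where x_i = 0. A dual KKM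
theorem, `stdSimplex.exists_forall_nonneg`, makes all h_i nonnegative, hence zero, at a common
point: M - v_i = x_i G. SANN yields an agent with x_k > 0 attaining M, so G = 0 and all values
agree. SANP follows by negation.

The covering theorem is the limit of a statement on coloured grids, with Scarf's lemma replacing
Sperner triangulations. The coordinates serve as rankings; a dominant family leaves no room for a
grid point above its coordinatewise minima, which forces it to cluster. Scarf's lemma itself is a
parity count of doors and rooms. -/

namespace Scarf

/-! ### Scarf's lemma and its grid form -/

open Finset

variable {V ι : Type*}

/-- A set `S` is dominant for the rankings `r` if every element is, in some ranking, weakly below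
all of `S`. -/
def Dominant (r : ι → V → ℕ) (S : Finset V) : Prop :=
  ∀ y, ∃ i, ∀ x ∈ S, r i y ≤ r i x

theorem Dominant.mono {r : ι → V → ℕ} {S D : Finset V} (hS : Dominant r S) (h : D ⊆ S) :
    Dominant r D := fun y ↦ (hS y).imp fun _ hi x hx ↦ hi x (h hx)

variable [DecidableEq V] [Fintype ι] [DecidableEq ι]

/-- A nonempty dominant set `D` with one element fewer than there are rankings has exactly two
dominant extensions by one element, provided each ranking can be left out. -/
theorem Dominant.exists_pair [Fintype V] {r : ι → V → ℕ} (hr : ∀ i, Function.Injective (r i))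
    {D : Finset V} (hD : Dominant r D) (hcard : #D + 1 = Fintype.card ι) (hne : D.Nonempty)
    (hM : ∀ i, ∃ y, ∀ j, j ≠ i → ∃ x ∈ D, r j x < r j y) :
    ∃ x y, x ≠ y ∧ ∀ z, (z ∉ D ∧ Dominant r (insert z D)) ↔ (z = x ∨ z = y) := by
  classical
  -- Dominance makes the minimum map `m` surjective onto `D`. There is one ranking more than
  -- elements, so exactly one pair `a`, `b` shares its minimum; a new element can take over the
  -- minimum only in one of these two rankings.
  have hmin : ∀ i, ∃ m ∈ D, ∀ x ∈ D, r i m ≤ r i x := fun i ↦ D.exists_min_image (r i) hne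
  choose m hmD hm using hmin
  have hsurj : ∀ y ∈ D, ∃ i, m i = y := fun y hy ↦ by
    obtain ⟨i, hi⟩ := hD y
    exact ⟨i, hr i (le_antisymm (hm i y hy) (hi _ (hmD i)))⟩
  obtain ⟨a, -, b, -, hab, hmab⟩ : ∃ a ∈ (univ : Finset ι), ∃ b ∈ (univ : Finset ι),
      a ≠ b ∧ m a = m b :=
    exists_ne_map_eq_of_card_lt_of_maps_to (by rw [card_univ]; omega) (fun i _ ↦ hmD i)
  -- `t i` is the only candidate for a new minimum in ranking `i`: the highest element there among
  -- those above the minima of all other rankings.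
  have hmax : ∀ i, ∃ y, (∀ j, j ≠ i → r j (m j) < r j y) ∧
      ∀ z, (∀ j, j ≠ i → r j (m j) < r j z) → r i z ≤ r i y := fun i ↦ by
    obtain ⟨y, hy⟩ := hM i
    obtain ⟨w, hw, hw'⟩ := (univ.filter fun y ↦ ∀ j, j ≠ i → r j (m j) < r j y).exists_max_image
      (r i) ⟨y, by
        simp only [mem_filter, mem_univ, true_and]
        intro j hj
        obtain ⟨x, hx, hxy⟩ := hy j hj
        exact (hm j x hx).trans_lt hxy⟩
    simp only [mem_filter, mem_univ, true_and] at hw hw'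
    exact ⟨w, hw, hw'⟩
  choose t ht htmax using hmax
  have hext : ∀ i, (∃ j, j ≠ i ∧ m j = m i) → t i ∉ D ∧ Dominant r (insert (t i) D) := by
    rintro i ⟨j, hji, hj⟩
    refine ⟨fun h ↦ ?_, fun y ↦ ?_⟩
    · obtain ⟨k, hk⟩ := hsurj _ h
      by_cases hki : k = i
      · subst hki
        exact absurd (ht k j hji) (by rw [← hk, hj]; exact lt_irrefl _)
      · exact absurd (ht i k hki) (by rw [← hk]; exact lt_irrefl _)
    · by_cases hy : ∀ k, k ≠ i → r k (m k) < r k y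
      · obtain ⟨k, hk⟩ := hD y
        have : k = i := by
          by_contra hki
          exact absurd (hk _ (hmD k)) (not_le.2 (hy k hki))
        subst this
        exact ⟨k, by simpa using ⟨htmax k y hy, hk⟩⟩
      · push Not at hy
        obtain ⟨k, hki, hk⟩ := hy
        exact ⟨k, by simpa using ⟨hk.trans (ht i k hki).le, fun x hx ↦ hk.trans (hm k x hx)⟩⟩
  refine ⟨t a, t b, fun h ↦ ?_, fun z ↦ ⟨?_, ?_⟩⟩
  · obtain ⟨i, hi⟩ := hD (t a)
    have hi := hi _ (hmD i)
    by_cases hia : i = a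
    · exact absurd hi (not_le.2 (h ▸ ht b i (hia ▸ hab)))
    · exact absurd hi (not_le.2 (ht a i hia))
  · rintro ⟨hz, hdom⟩
    obtain ⟨i, hi⟩ := hdom z
    have hzi : ∀ x ∈ D, r i z < r i x := fun x hx ↦
      lt_of_le_of_ne (hi x (mem_insert_of_mem hx)) fun h ↦ hz (hr i h ▸ hx)
    have hcov : ∀ y ∈ D, ∃ k, m k = y ∧ r k y ≤ r k z := fun y hy ↦ by
      obtain ⟨k, hk⟩ := hdom y
      exact ⟨k, hr k (le_antisymm (hm k y hy) (hk _ (mem_insert_of_mem (hmD k)))),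
        hk z (mem_insert_self _ _)⟩
    -- Since `z` is the new minimum in ranking `i`, the other rankings must supply every element of
    -- `D`; by counting, `m` is injective on them, so `i` is `a` or `b`.
    have hDsub : D ⊆ (univ.erase i).image m := fun y hy ↦ by
      obtain ⟨k, hk, hkz⟩ := hcov y hy
      refine mem_image.2 ⟨k, mem_erase.2 ⟨?_, mem_univ _⟩, hk⟩
      rintro rfl
      exact absurd hkz (not_le.2 (hzi y hy))
    have hce : #(univ.erase i) = #D := by
      rw [card_erase_of_mem (mem_univ _), card_univ]; omega
    have hinj : Set.InjOn m (univ.erase i : Finset ι) :=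
      card_image_iff.1 (le_antisymm card_image_le (hce ▸ card_le_card hDsub))
    have hzj : ∀ j, j ≠ i → r j (m j) < r j z := by
      intro j hj
      obtain ⟨k, hk, hkz⟩ := hcov (m j) (hmD j)
      have hki : k ≠ i := by
        rintro rfl
        exact absurd hkz (not_le.2 (hzi _ (hmD j)))
      have : k = j := hinj (by simpa using hki) (by simpa using hj) hk
      subst this
      exact lt_of_le_of_ne hkz fun h ↦ hz (hr k h ▸ hmD k)
    have hzt : z = t i := by
      refine hr i (le_antisymm (htmax i z hzj) ?_)
      obtain ⟨k, hk⟩ := hdom (t i)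
      have : k = i := by
        by_contra hki
        exact absurd (hk _ (mem_insert_of_mem (hmD k))) (not_le.2 (ht i k hki))
      subst this
      exact hk z (mem_insert_self _ _)
    by_cases hia : i = a
    · exact Or.inl (hia ▸ hzt)
    by_cases hib : i = b
    · exact Or.inr (hib ▸ hzt)
    exact absurd (hinj (by simpa using Ne.symm hia) (by simpa using Ne.symm hib) hmab) hab
  · rintro (rfl | rfl)
    · exact hext a ⟨b, hab.symm, hmab.symm⟩
    · exact hext b ⟨a, hab, hmab⟩

/-- If `c` does not map `S` onto the set of colours, the number of elements of `S` whose removal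
leaves exactly the colours other than `k` is even. -/
theorem even_card_filter_image_erase (c : V → ι) (k : ι) {S : Finset V}
    (hS : #S = Fintype.card ι) (hc : S.image c ≠ univ) :
    Even #(S.filter fun x ↦ (S.erase x).image c = univ.erase k) := by
  classical
  rcases (S.filter fun x ↦ (S.erase x).image c = univ.erase k).eq_empty_or_nonempty with h | ⟨x, hx⟩
  · simp [h]
  rw [mem_filter] at hx
  obtain ⟨hxS, hx⟩ := hx
  have hxk : c x ≠ k := by
    intro h
    apply hc
    rw [← insert_erase hxS, image_insert, hx, h, insert_erase (mem_univ k)]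
  -- The colour of `x` occurs exactly once more in `S`, at `y`; only these two elements can be
  -- removed without losing a colour.
  obtain ⟨y, hy, hyx⟩ : ∃ y ∈ S.erase x, c y = c x :=
    mem_image.1 (hx ▸ mem_erase.2 ⟨hxk, mem_univ _⟩)
  have hcard : #((S.erase x).image c) = #(S.erase x) := by
    rw [hx, card_erase_of_mem (mem_univ _), card_erase_of_mem hxS, hS, card_univ]
  have hinj := card_image_iff.1 hcard
  have hyS := mem_of_mem_erase hy
  have hyx' := ne_of_mem_erase hy
  have himS : S.image c = univ.erase k := by
    rw [← insert_erase hxS, image_insert, hx, insert_eq_self]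
    exact mem_erase.2 ⟨hxk, mem_univ _⟩
  have : S.filter (fun x ↦ (S.erase x).image c = univ.erase k) = {x, y} := by
    ext z
    simp only [mem_filter, mem_insert, mem_singleton]
    constructor
    · rintro ⟨hzS, hz⟩
      by_contra! hne
      have hzm : c z ∈ (S.erase z).image c := by
        rw [hz, ← himS]
        exact mem_image_of_mem c hzS
      obtain ⟨w, hw, hwz⟩ := mem_image.1 hzm
      have hwS := mem_of_mem_erase hw
      by_cases hwx : w = x
      · exact hne.2 (hinj (by simpa using ⟨hzS, hne.1⟩) (by simpa using ⟨hyS, hyx'⟩)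
          (by rw [← hwz, hwx, hyx]))
      · exact (ne_of_mem_erase hw) (hinj (by simpa using ⟨hwS, hwx⟩)
          (by simpa using ⟨hzS, hne.1⟩) hwz)
    · rintro (rfl | rfl)
      · exact ⟨hxS, hx⟩
      · refine ⟨hyS, ?_⟩
        rw [← himS]
        refine (image_subset_image (erase_subset _ _)).antisymm fun i hi ↦ ?_
        obtain ⟨w, hw, rfl⟩ := mem_image.1 hi
        by_cases hwz : w = z
        · exact mem_image.2 ⟨x, mem_erase.2 ⟨hwz ▸ hyx'.symm, hxS⟩, by rw [hwz, hyx]⟩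
        · exact mem_image.2 ⟨w, mem_erase.2 ⟨hwz, hw⟩, rfl⟩
  rw [this, card_pair hyx'.symm]
  exact even_two

/-- Scarf's parity argument: if exactly one set with the colours other than `k` has a unique
dominant extension by one element and every other has an even number of them, then some dominant
set has all colours. -/
theorem exists_dominant_image_eq_univ [Fintype V] (r : ι → V → ℕ) (c : V → ι) (k : ι) (D₀ : Finset V)
    (hD₀ : #D₀ + 1 = Fintype.card ι) (hcD₀ : D₀.image c = univ.erase k)
    (hone : ∃! x, x ∉ D₀ ∧ Dominant r (insert x D₀))
    (htwo : ∀ D : Finset V, D ≠ D₀ → #D + 1 = Fintype.card ι → D.image c = univ.erase k →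
      Dominant r D →
      ∃ x y, x ≠ y ∧ ∀ z, (z ∉ D ∧ Dominant r (insert z D)) ↔ (z = x ∨ z = y)) :
    ∃ S : Finset V, Dominant r S ∧ S.image c = univ := by
  classical
  by_contra! hno
  let rooms : Finset (Finset V) := univ.filter fun S ↦ #S = Fintype.card ι ∧ Dominant r S
  let doors : Finset (Finset V) := univ.filter fun D ↦
    #D + 1 = Fintype.card ι ∧ D.image c = univ.erase k
  -- Incidences of doors and rooms are counted twice: by rooms the total is even, by doors it is odd
  -- because of `D₀`.
  have hcount : #(rooms.sigma fun S ↦ S.filter fun x ↦ (S.erase x).image c = univ.erase k) =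
      #(doors.sigma fun D ↦ univ.filter fun x ↦ x ∉ D ∧ Dominant r (insert x D)) := by
    refine card_bij' (fun p _ ↦ ⟨p.1.erase p.2, p.2⟩) (fun p _ ↦ ⟨insert p.2 p.1, p.2⟩)
      ?_ ?_ ?_ ?_
    · rintro ⟨S, x⟩ h
      simp only [mem_sigma, rooms, doors, mem_filter, mem_univ, true_and] at h ⊢
      obtain ⟨⟨h1, h2⟩, h3, h4⟩ := h
      exact ⟨⟨by rw [card_erase_add_one h3, h1], h4⟩, notMem_erase _ _, by rwa [insert_erase h3]⟩
    · rintro ⟨D, x⟩ h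
      simp only [mem_sigma, rooms, doors, mem_filter, mem_univ, true_and] at h ⊢
      obtain ⟨⟨h1, h2⟩, h3, h4⟩ := h
      exact ⟨⟨by rw [card_insert_of_notMem h3, h1], h4⟩, mem_insert_self _ _,
        by rwa [erase_insert h3]⟩
    · rintro ⟨S, x⟩ h
      simp only [mem_sigma, mem_filter] at h
      simp [insert_erase h.2.1]
    · rintro ⟨D, x⟩ h
      simp only [mem_sigma, mem_filter] at h
      simp [erase_insert h.2.2.1]
  rw [card_sigma, card_sigma] at hcount
  have heven : Even (∑ S ∈ rooms, #(S.filter fun x ↦ (S.erase x).image c = univ.erase k)) := by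
    refine even_sum _ fun S hS ↦ ?_
    simp only [rooms, mem_filter, mem_univ, true_and] at hS
    exact even_card_filter_image_erase c k hS.1 (hno S hS.2)
  rw [hcount, ← add_sum_erase doors _ (a := D₀) (by simp [doors, hD₀, hcD₀])] at heven
  have hrest : Even (∑ D ∈ doors.erase D₀,
      #(univ.filter fun x ↦ x ∉ D ∧ Dominant r (insert x D))) := by
    refine even_sum _ fun D hD ↦ ?_
    simp only [doors, mem_erase, mem_filter, mem_univ, true_and] at hD
    by_cases hdom : Dominant r D
    · obtain ⟨x, y, hxy, h⟩ := htwo D hD.1 hD.2.1 hD.2.2 hdom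
      have : (univ.filter fun x ↦ x ∉ D ∧ Dominant r (insert x D)) = {x, y} := by
        ext z; simp [h]
      rw [this, card_pair hxy]
      exact even_two
    · rw [filter_false_of_mem fun x _ h ↦ hdom (h.2.mono (subset_insert _ _))]
      simp
  obtain ⟨x, hx, hx'⟩ := hone
  have : (univ.filter fun x ↦ x ∉ D₀ ∧ Dominant r (insert x D₀)) = {x} := by
    ext z
    simp only [mem_filter, mem_univ, true_and, mem_singleton]
    exact ⟨hx' z, fun h ↦ h ▸ hx⟩
  rw [this, card_singleton] at heven
  rw [Nat.even_add] at heven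
  exact absurd (heven.2 hrest) (by decide)

/-- Scarf's lemma for weak rankings: for every colouring `c` of a finite set `V` by the indices of
the rankings `r` there are a set `C` of colours and a `C`-coloured family in `V` that is dominant
with respect to the rankings in `C`. -/
theorem exists_colored_family {V ι : Type*} [Fintype V] [Nonempty V] [Fintype ι] [Nonempty ι]
    (r : ι → V → ℕ) (c : V → ι) :
    ∃ (C : Finset ι) (p : ι → V), (∀ i ∈ C, c (p i) = i) ∧
      ∀ y, ∃ i ∈ C, ∀ j ∈ C, r i y ≤ r i (p j) := by
  classical
  let e := Fintype.equivFin V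
  let f := Fintype.equivFin ι
  -- Ties are broken by the enumeration `e`; the `+ 1` keeps value 0 free for the slack elements.
  let q : ι → V → ℕ := fun i v ↦ r i v * Fintype.card V + e v + 1
  have hq : ∀ i, Function.Injective (q i) := fun i v w h ↦ by
    have h : r i v * Fintype.card V + e v = r i w * Fintype.card V + e w := by simpa [q] using h
    have h' := congrArg (· % Fintype.card V) h
    simp only [Nat.mul_add_mod_self_right, Nat.mod_eq_of_lt (e v).2, Nat.mod_eq_of_lt (e w).2] at h'
    exact e.injective (Fin.ext h')
  have hqr : ∀ i v w, q i v ≤ q i w → r i v ≤ r i w := fun i v w h ↦ by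
    by_contra! hlt
    have h1 : (r i w + 1) * Fintype.card V ≤ r i v * Fintype.card V := Nat.mul_le_mul_right _ hlt
    have h2 := (e w).2
    simp only [q, add_mul] at h h1
    omega
  obtain ⟨B, hB⟩ : ∃ B, ∀ i v, q i v < B :=
    ⟨∑ i, ∑ v, q i v + 1, fun i v ↦ Nat.lt_succ_of_le
      ((single_le_sum (f := fun v ↦ q i v) (fun _ _ ↦ Nat.zero_le _) (mem_univ v)).trans
        (single_le_sum (f := fun i ↦ ∑ v, q i v) (fun _ _ ↦ Nat.zero_le _) (mem_univ i)))⟩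
  -- Slack `j` has colour `j`, lies at the bottom of ranking `j` and above all of `V` in the others.
  let R : ι → V ⊕ ι → ℕ := fun i ↦ Sum.elim (q i) fun j ↦ if j = i then 0 else B + f j
  have hRl : ∀ i v, R i (.inl v) = q i v := fun _ _ ↦ rfl
  have hRs : ∀ i, R i (.inr i) = 0 := fun i ↦ by simp [R]
  have hRn : ∀ {i j}, j ≠ i → R i (.inr j) = B + f j := fun h ↦ by simp [R, h]
  have hqpos : ∀ i v, 0 < q i v := fun i v ↦ Nat.succ_pos _
  have hR : ∀ i, Function.Injective (R i) := by
    rintro i (v | j) (w | k) h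
    · exact congrArg _ (hq i h)
    · have h1 := hB i v
      have h2 := hqpos i v
      by_cases hk : k = i
      · rw [hk, hRl, hRs] at h; omega
      · rw [hRl, hRn hk] at h; omega
    · have h1 := hB i w
      have h2 := hqpos i w
      by_cases hk : j = i
      · rw [hk, hRl, hRs] at h; omega
      · rw [hRl, hRn hk] at h; omega
    · by_cases hj : j = i <;> by_cases hk : k = i
      · rw [hj, hk]
      · have := hB i (Classical.arbitrary V)
        rw [hj, hRs, hRn hk] at h; omega
      · have := hB i (Classical.arbitrary V)
        rw [hk, hRs, hRn hj] at h; omega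
      · rw [hRn hj, hRn hk] at h
        exact congrArg _ (f.injective (Fin.ext (by omega)))
  let k : ι := Classical.arbitrary ι
  let D₀ : Finset (V ⊕ ι) := (univ.erase k).image Sum.inr
  have hcD : ∀ j : ι, #((univ.erase j).image (Sum.inr : ι → V ⊕ ι)) + 1 = Fintype.card ι :=
    fun j ↦ by
      rw [card_image_of_injective _ Sum.inr_injective, card_erase_add_one (mem_univ _), card_univ]
  have hone : ∃! x, x ∉ D₀ ∧ Dominant R (insert x D₀) := by
    -- Each ranking other than `k` has its own slack in `D₀`, so only ranking `k` can dominate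
    -- elements of `V`; its top element is the unique extension.
    obtain ⟨w, -, hw⟩ := (univ : Finset V).exists_max_image (q k) univ_nonempty
    refine ⟨.inl w, ⟨by simp [D₀], ?_⟩, ?_⟩
    · rintro (v | j)
      · refine ⟨k, fun x hx ↦ ?_⟩
        rcases mem_insert.1 hx with rfl | hx
        · exact hw v (mem_univ _)
        · obtain ⟨j, hj, rfl⟩ := mem_image.1 hx
          rw [hRn (ne_of_mem_erase hj), hRl]
          exact (hB k v).le.trans (Nat.le_add_right _ _)
      · exact ⟨j, fun x _ ↦ by rw [hRs]; exact Nat.zero_le _⟩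
    · rintro (v | j) ⟨hx, hdom⟩
      · obtain ⟨i, hi⟩ := hdom (.inl w)
        have hik : i = k := by
          by_contra h
          have := hi (.inr i) (by simp [D₀, h])
          rw [hRs, hRl] at this
          exact absurd (hqpos i w) (by omega)
        rw [hik] at hi
        exact hR k (le_antisymm (hw v (mem_univ _)) (hi _ (mem_insert_self _ _)))
      · have hjk : j = k := by simpa [D₀] using hx
        obtain ⟨i, hi⟩ := hdom (.inl w)
        have := hi (.inr i) (by by_cases h : i = k <;> simp [D₀, h, hjk])
        rw [hRs, hRl] at this
        exact absurd (hqpos i w) (by omega)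
  obtain ⟨S, hS, hcS⟩ := exists_dominant_image_eq_univ R (Sum.elim c id) k D₀ (hcD k)
    (by rw [image_image]; exact image_id) hone fun D hD hcard hcol hdom ↦ by
      refine hdom.exists_pair hR hcard ?_ fun i ↦ ?_
      · rw [nonempty_iff_ne_empty]
        rintro rfl
        refine hD (card_eq_zero.1 ?_).symm
        have : #D₀ + 1 = Fintype.card ι := hcD k
        rw [card_empty] at hcard
        omega
      -- Slack `i` exceeds some element of `D` in ranking `j`, unless `D` is all slacks but `j`; the
      -- colours then force `j = k`, so `D = D₀`.
      · refine ⟨.inr i, fun j hj ↦ ?_⟩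
        by_contra! hle
        have hsub : D ⊆ (univ.erase j).image Sum.inr := by
          rintro (v | l) hx
          · have := hle _ hx
            rw [hRn hj.symm, hRl] at this
            exact absurd (hB j v) (by omega)
          · by_cases hl : l = j
            · have := hle _ hx
              have h0 := hB j (Classical.arbitrary V)
              rw [hRn hj.symm, hl, hRs] at this
              omega
            · simp [hl]
        have hDeq := eq_of_subset_of_card_le hsub (by have := hcD j; omega)
        have hjk : j = k := by
          rw [hDeq, image_image] at hcol
          have h : k ∉ (univ.erase j).image (Sum.elim c id ∘ Sum.inr) := by
            rw [hcol]; exact notMem_erase _ _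
          by_contra hne
          exact h (mem_image.2 ⟨k, by simpa using Ne.symm hne, rfl⟩)
        exact hD (by rw [hDeq, hjk])
  have hp : ∀ i, ∃ v : V, .inr i ∉ S → .inl v ∈ S ∧ c v = i := fun i ↦ by
    by_cases h : .inr i ∈ S
    · exact ⟨Classical.arbitrary V, fun h' ↦ absurd h h'⟩
    · obtain ⟨v | j, hx, hxi⟩ := mem_image.1 (hcS ▸ mem_univ i)
      · exact ⟨v, fun _ ↦ ⟨hx, hxi⟩⟩
      · obtain rfl : j = i := hxi
        exact absurd hx h
  choose p hp using hp
  -- A colour whose slack is missing from `S` must come from `V`, and a ranking whose slack is in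
  -- `S` dominates no element of `V`.
  refine ⟨univ.filter fun i ↦ .inr i ∉ S, p, fun i hi ↦ (hp i (by simpa using hi)).2, fun y ↦ ?_⟩
  obtain ⟨i, hi⟩ := hS (.inl y)
  refine ⟨i, mem_filter.2 ⟨mem_univ _, fun h ↦ ?_⟩, fun j hj ↦
    hqr i _ _ (hi _ (hp j (by simpa using hj)).1)⟩
  have := hi _ h
  rw [hRs, hRl] at this
  exact absurd (hqpos i y) (by omega)

/-- Discrete form of the covering lemma on the grid of mesh `1 / N` in a simplex. -/
theorem exists_close_grid_points {ι : Type*} [Fintype ι] [Nonempty ι] (N : ℕ)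
    (c : {x : ι → ℕ // ∑ i, x i = N} → ι) :
    ∃ (x : {x : ι → ℕ // ∑ i, x i = N}) (z : ι → {x : ι → ℕ // ∑ i, x i = N}), ∀ i,
      (∀ j, (x.1 j ≤ (z i).1 j + Fintype.card ι) ∧ ((z i).1 j ≤ x.1 j + Fintype.card ι)) ∧
      (c (z i) = i ∨ (z i).1 i ≤ Fintype.card ι) := by
  classical
  have : Finite {x : ι → ℕ // ∑ i, x i = N} :=
    ((univ.piAntidiag N).finite_toSet.subset fun x hx ↦ by
      simpa using hx : {x : ι → ℕ | ∑ i, x i = N}.Finite)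
  have := Fintype.ofFinite {x : ι → ℕ // ∑ i, x i = N}
  have : Nonempty {x : ι → ℕ // ∑ i, x i = N} :=
    ⟨⟨Pi.single (Classical.arbitrary ι) N, by simp⟩⟩
  obtain ⟨C, p, hc, hp⟩ := exists_colored_family (fun i (x : {x : ι → ℕ // ∑ i, x i = N}) ↦ x.1 i) c
  obtain ⟨a, ha, -⟩ := hp (Classical.arbitrary _)
  have hmin : ∀ i, ∃ l ∈ C, ∀ j ∈ C, (p l).1 i ≤ (p j).1 i := fun i ↦
    C.exists_min_image (fun j ↦ (p j).1 i) ⟨a, ha⟩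
  choose l hlC hl using hmin
  set m : ι → ℕ := fun i ↦ (p (l i)).1 i with hm
  -- Otherwise some grid point exceeds `m i` in every coordinate `i ∈ C`, against dominance; the
  -- surplus is put on coordinate `a`.
  have hsum : N < ∑ i ∈ C, (m i + 1) := by
    by_contra! hle
    obtain ⟨i, hi, hy⟩ := hp ⟨fun i ↦ (if i ∈ C then m i + 1 else 0) +
      if i = a then N - ∑ i ∈ C, (m i + 1) else 0, by
        rw [sum_add_distrib, ← sum_filter, filter_mem_eq_inter, univ_inter, sum_ite_eq']
        simp only [mem_univ, if_true]
        omega⟩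
    have := hy (l i) (hlC i)
    simp only [hi, if_true] at this
    simp only [hm] at this
    omega
  have hcard : #C ≤ Fintype.card ι := card_le_univ C
  rw [sum_add_distrib, sum_const, smul_eq_mul, mul_one] at hsum
  -- The minima over `C` add up to more than `N - #C`, so no coordinate can exceed its lower bound
  -- by `#C` or more.
  have hout : ∀ k ∈ C, ∀ j, (p k).1 j ≤ (if j ∈ C then m j else 0) + Fintype.card ι := by
    intro k hk j
    have h1 : ∑ i ∈ univ.erase j, (if i ∈ C then m i else 0) ≤ ∑ i ∈ univ.erase j, (p k).1 i := by
      refine sum_le_sum fun i _ ↦ ?_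
      split_ifs with h
      · exact hl i k hk
      · exact Nat.zero_le _
    have h2 := add_sum_erase univ (fun i ↦ if i ∈ C then m i else 0) (mem_univ j)
    have h3 := add_sum_erase univ (p k).1 (mem_univ j)
    rw [(p k).2] at h3
    have h4 : ∑ i, (if i ∈ C then m i else 0) = ∑ i ∈ C, m i := by
      rw [← sum_filter, filter_mem_eq_inter, univ_inter]
    rw [h4] at h2
    omega
  have hlow : ∀ k ∈ C, ∀ j, (if j ∈ C then m j else 0) ≤ (p k).1 j := fun k hk j ↦ by
    split_ifs
    · exact hl j k hk
    · exact Nat.zero_le _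
  refine ⟨p a, fun i ↦ if i ∈ C then p i else p a, fun i ↦ ?_⟩
  by_cases hi : i ∈ C
  · simp only [hi, if_true]
    refine ⟨fun j ↦ ?_, Or.inl (hc i hi)⟩
    have h1 := hout a ha j
    have h2 := hout i hi j
    have h3 := hlow a ha j
    have h4 := hlow i hi j
    omega
  · simp only [hi, if_false]
    refine ⟨fun j ↦ by omega, Or.inr ?_⟩
    simpa [hi] using hout a ha i

end Scarf

/-! ### Dual KKM covering theorem -/

section

open Filter Topology

/-- If continuous functions `h i` on the standard simplex are such that at every point some `h i`
is nonnegative, and `h i` is nonnegative on the face `x i = 0`, then they are simultaneously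
nonnegative somewhere. -/
theorem stdSimplex.exists_forall_nonneg {ι : Type*} [Fintype ι] [Nonempty ι]
    (h : ι → stdSimplex ℝ ι → ℝ) (hcont : ∀ i, Continuous (h i))
    (hex : ∀ x, ∃ i, 0 ≤ h i x) (hface : ∀ i x, x i = 0 → 0 ≤ h i x) :
    ∃ x, ∀ i, 0 ≤ h i x := by
  choose c hc using hex
  let s : (N : ℕ) → {x : ι → ℕ // ∑ i, x i = N + 1} → stdSimplex ℝ ι := fun N x ↦
    ⟨fun i ↦ (x.1 i : ℝ) / (N + 1 : ℝ), fun i ↦ by positivity, by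
      rw [← Finset.sum_div, ← Nat.cast_sum, x.2]
      push_cast
      exact div_self (by positivity)⟩
  have hs : ∀ N x i, s N x i = (x.1 i : ℝ) / (N + 1 : ℝ) := fun _ _ _ ↦ rfl
  choose x z hxz using fun N ↦ Scarf.exists_close_grid_points (N + 1) fun x ↦ c (s N x)
  obtain ⟨y, φ, hφ, hy⟩ := CompactSpace.tendsto_subseq fun N ↦ s N (x N)
  have hzero : Tendsto (fun N : ℕ ↦ (Fintype.card ι : ℝ) / ((φ N : ℝ) + 1)) atTop (𝓝 0) := by
    have := (tendsto_const_div_atTop_nhds_zero_nat (Fintype.card ι : ℝ)).comp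
      ((tendsto_add_atTop_nat 1).comp hφ.tendsto_atTop)
    refine this.congr fun N ↦ ?_
    simp
  have hcoord : ∀ j, Continuous fun w : stdSimplex ℝ ι ↦ w j := fun j ↦
    (continuous_apply j).comp continuous_subtype_val
  have hz : ∀ i, Tendsto (fun N ↦ s (φ N) (z (φ N) i)) atTop (𝓝 y) := fun i ↦ by
    rw [tendsto_subtype_rng, tendsto_pi_nhds]
    intro j
    have h1 : Tendsto (fun N ↦ s (φ N) (z (φ N) i) j - s (φ N) (x (φ N)) j) atTop (𝓝 0) := by
      refine squeeze_zero_norm (fun N ↦ ?_) hzero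
      rw [hs, hs, ← sub_div, norm_div, Real.norm_of_nonneg (by positivity : (0 : ℝ) ≤ φ N + 1)]
      gcongr
      obtain ⟨h1, h2⟩ := (hxz (φ N) i).1 j
      rw [Real.norm_eq_abs, abs_sub_le_iff]
      constructor
      · rw [sub_le_iff_le_add']; exact_mod_cast h2
      · rw [sub_le_iff_le_add']; exact_mod_cast h1
    have h2 := h1.add (((hcoord j).tendsto y).comp hy)
    simp only [Function.comp_apply, sub_add_cancel, zero_add] at h2
    exact h2
  refine ⟨y, fun i ↦ ?_⟩
  -- Which alternative of `hxz` holds may vary with `N`; a minimum that is nonpositive in both cases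
  -- avoids choosing a further subsequence.
  have hlim := (((hcont i).tendsto y).comp (hz i)).neg.min
    ((((hcoord i).tendsto y).comp (hz i)).sub hzero)
  have hle := le_of_tendsto' hlim (b := 0) fun N ↦ by
    rcases (hxz (φ N) i).2 with h1 | h1
    · refine min_le_of_left_le (neg_nonpos.2 ?_)
      have := hc (s (φ N) (z (φ N) i))
      rwa [h1] at this
    · refine min_le_of_right_le (sub_nonpos.2 ?_)
      change s (φ N) (z (φ N) i) i ≤ _
      rw [hs]
      gcongr
  rw [sub_zero] at hle
  rcases min_le_iff.1 hle with h1 | h1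
  · exact neg_nonpos.1 h1
  · exact hface i y (le_antisymm h1 (y.2.1 i))

end

/-! ### Equitable cut-sets -/

namespace CakeCutting.Instance

variable {n : ℕ}

/-- A SANN instance has an equitable cut-set. -/
theorem IsSANN.exists_isEquitable (hn : 0 < n) {I : Instance n} (hI : I.IsSANN) :
    ∃ x, I.IsEquitable x := by
  have : Nonempty (Fin n) := ⟨⟨0, hn⟩⟩
  let M : CutSet n → ℝ := fun x ↦ Finset.univ.sup' Finset.univ_nonempty fun i ↦ I.val i x
  have hM : Continuous M := Continuous.finset_sup'_apply _ fun i _ ↦ I.continuous_val i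
  have hle : ∀ i x, I.val i x ≤ M x := fun i x ↦
    Finset.le_sup' (fun i ↦ I.val i x) (Finset.mem_univ i)
  let G : CutSet n → ℝ := fun x ↦ ∑ j, (M x - I.val j x)
  have hG : Continuous G := continuous_finsetSum _ fun j _ ↦ hM.sub (I.continuous_val j)
  let h : Fin n → CutSet n → ℝ := fun i x ↦ M x - I.val i x - x i * G x
  have hsum : ∀ x, ∑ i, h i x = 0 := fun x ↦ by
    have h1 : ∑ i, x i = 1 := x.2.2
    simp only [h]
    rw [Finset.sum_sub_distrib, ← Finset.sum_mul, h1, one_mul, sub_self]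
  obtain ⟨x, hx⟩ := stdSimplex.exists_forall_nonneg h
    (fun i ↦ (hM.sub (I.continuous_val i)).sub
      (((continuous_apply i).comp continuous_subtype_val).mul hG))
    (fun x ↦ by
      by_contra! hneg
      exact absurd (hsum x) (Finset.sum_neg (fun i _ ↦ hneg i) Finset.univ_nonempty).ne)
    (fun i x hxi ↦ by simp only [h, hxi, zero_mul, sub_zero, sub_nonneg]; exact hle i x)
  have hzero : ∀ i, h i x = 0 := fun i ↦
    (Finset.sum_eq_zero_iff_of_nonneg fun i _ ↦ hx i).1 (hsum x) i (Finset.mem_univ i)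
  -- If a maximiser has an empty piece then `M x = 0`, and the agent given by SANN attains it with a
  -- nonempty piece.
  obtain ⟨k, hk, hkM⟩ : ∃ k, 0 < x k ∧ I.val k x = M x := by
    obtain ⟨i, -, hi⟩ := Finset.exists_mem_eq_sup' Finset.univ_nonempty fun i ↦ I.val i x
    change M x = _ at hi
    rcases (x.2.1 i).eq_or_lt with h0 | hpos
    · obtain ⟨k, hk, hk0⟩ := hI x
      rw [I.val_eq_zero i x h0.symm] at hi
      exact ⟨k, hk, le_antisymm (hle k x) (hi ▸ hk0)⟩
    · exact ⟨i, hpos, hi.symm⟩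
  have hG0 : G x = 0 := by
    have := hzero k
    simp only [h, hkM, sub_self, zero_sub, neg_eq_zero] at this
    exact (mul_eq_zero.1 this).resolve_left hk.ne'
  have hval : ∀ i, I.val i x = M x := fun i ↦ by
    have := hzero i
    simp only [h, hG0, mul_zero, sub_zero] at this
    linarith
  exact ⟨x, fun i j ↦ (hval i).trans (hval j).symm⟩

/-- The instance with all valuations negated. -/
def neg (I : Instance n) : Instance n where
  val i x := -I.val i x
  continuous_val i := (I.continuous_val i).neg
  val_eq_zero i x hx := by rw [I.val_eq_zero i x hx, neg_zero]

/-- A SANP instance has an equitable cut-set. -/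
theorem IsSANP.exists_isEquitable (hn : 0 < n) {I : Instance n} (hI : I.IsSANP) :
    ∃ x, I.IsEquitable x := by
  have hneg : I.neg.IsSANN := fun x ↦ (hI x).imp fun _ hi ↦ ⟨hi.1, neg_nonneg.2 hi.2⟩
  obtain ⟨x, hx⟩ := hneg.exists_isEquitable hn
  exact ⟨x, fun i j ↦ neg_injective (hx i j)⟩

end CakeCutting.Instance

theorem theorem1 {n : ℕ} (hn : 0 < n) (I : CakeCutting.Instance n)
    (hI : I.IsSANN ∨ I.IsSANP) :
    ∃ A : Fin n → Set ℝ, I.IsConnectedEquitableAllocation A := by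
  obtain ⟨x, hx⟩ : ∃ x, I.IsEquitable x :=
    hI.elim (fun h ↦ h.exists_isEquitable hn) (fun h ↦ h.exists_isEquitable hn)
  exact ⟨x.allocation, x, rfl, hx⟩
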